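/- For sequences $(a_n)_{n\ge 0}$, $(b_n)_{n\ge 1}$ of complex numbers let $$\mathrm{CF}[a_n,b_n]=a_0+\cfrac{b_1}{a_1+\cfrac{b_2}{a_2+\ddots}}$$ denote the limit in the Riemann sphere $\mathbb C\cup\{\infty\}$ of the convergents $A_n/B_n$, where $A_0=1$, $A_1=a_0$, $B_0=0$, $B_1=1$, and $A_{n+1}=a_nA_n+b_nA_{n-1}$, $B_{n+1}=a_nB_n+b_nB_{n-1}$ for $n\ge 1$; existence of the limit includes that $(A_n,B_n)\ne(0,0)$ for all large $n$. Write $\Delta f_n=f_{n+1}-f_n$ and $(x)_n=x(x+1)\cdots(x+n-1)$, $(x)_0=1$. **Theorem.** Let $\alpha,\beta,\gamma\in\mathbb C$ satisfy $\operatorname{Re}(2\gamma-\alpha-\beta)<1$ and $\frac{\alpha+1}{2},\frac{\beta+1}{2},\gamma+1\notin\mathbb Z_{\le 0}$. Then the series $$S=\sum_{n=0}^{\infty}\frac{\left(\frac12\right)_n(\gamma+1)_n}{\left(\frac{\alpha+1}{2}\right)_{n+1}\left(\frac{\beta+1}{2}\right)_{n+1}}$$ converges absolutely, the continued fraction with partial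 denominators $a_n=\Delta\bigl(n(n+\alpha)(n+\beta)\bigr)$ and partial numerators $b_n=-2n(n+\alpha)(n+\beta)(n+\gamma)$ converges in the Riemann sphere, and $$\mathrm{CF}\left[\Delta\bigl(n(n+\alpha)(n+\beta)\bigr),\,-2n(n+\alpha)(n+\beta)(n+\gamma)\right]=\frac{4}{S},$$ where $4/S=\infty$ if $S=0$. -/

import Mathlib

open Filter Topology

noncomputable section

/-- The continued fraction `a 0 + b 1 / (a 1 + b 2 / (a 2 + ⋯))`. -/
def contFrac (a b : ℕ → ℂ) : GenContFract ℂ :=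
  ⟨a 0, Stream'.Seq.ofStream fun n => ⟨b (n + 1), a (n + 1)⟩⟩

/-- The quotient `p / q` as a point of the Riemann sphere, equal to `∞` when `q = 0`
(meant for pairs `(p, q) ≠ (0, 0)`). -/
def sphereDiv (p q : ℂ) : OnePoint ℂ :=
  if q = 0 then OnePoint.infty else ((p / q : ℂ) : OnePoint ℂ)

/-- A complex continued fraction has the value `z` in the Riemann sphere: from some index on its
convergents (canonical numerator over canonical denominator) are defined, i.e. not of the form
`0 / 0`, and they tend to `z`. -/
def HasCFValue (g : GenContFract ℂ) (z : OnePoint ℂ) : Prop :=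
  (∀ᶠ n in atTop, g.nums n ≠ 0 ∨ g.dens n ≠ 0) ∧
    Tendsto (fun n => sphereDiv (g.nums n) (g.dens n)) atTop (𝓝 z)

/-- The rising factorial `(x)_n = x (x + 1) ⋯ (x + n - 1)`. -/
def poch (x : ℂ) (n : ℕ) : ℂ := (ascPochhammer ℂ n).eval x

end

/-!
The numerators `A n` and denominators `B n` of the convergents solve the three-term recurrence
`X (n + 1) = a n * X n + b n * X (n - 1)`. After division by `n!²` its coefficients tend to those of
`Y (n + 1) = 3 Y n - 2 Y (n - 1)`, with characteristic roots `1` and `2`. So, in a quantitative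
form of Poincaré's theorem (`IsSolution.grows_or_small`), a solution is either *small* (at most
`C (11 / 10) ^ n * n!²`) or *grows* with ratio at least `7 / 5` after normalization.

A small solution is known explicitly. With `τ j = (γ + 1)_j / (((α + 1) / 2)_{j + 1}
((β + 1) / 2)_{j + 1})`, put `m n = ∑ k, (n + 2k)! / (2 ^ (n + 2k) k!) * τ (n + k)`. Creative
telescoping (`sum_tailTerm_recurrence`) shows that `-1 / 4 * (α + 1)_n (β + 1)_n * m n` solves the
recurrence. The summands are dominated by those of `S`, so `m` is bounded and this solution is
small; as `m 0 = S` and `m 1` is `S` without its first term, comparison of initial values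
identifies it with `B n - S / 4 * A n` (`Admissible.cfDen_sub_eq`).

It remains to see that `A` grows, for then `A n ≠ 0` eventually and `B n / A n` tends to `S / 4`,
which is the claim after an inversion of the Riemann sphere. If no `b n` vanishes, `A` cannot be
small, since otherwise `B` would be small too, against the growth of the Casoratian of `A` and `B`.
If `b N = 0` for some `N ≥ 1`, which happens when `α` or `β` is the even integer `-N`, all
solutions are, from the first such `N` on, multiples of the numerators for shifted parameters, and
the growth of these is inherited by `A` (`Admissible.grows_cfNum_of_shift`). Two shifts at most
reduce everything to the case of nonvanishing `b n`.
-/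

/-! ### The recurrence and its small solution -/

/-- The partial denominator `Δ (n (n + α) (n + β))`. -/
noncomputable def partDen (α β : ℂ) (n : ℕ) : ℂ :=
  (n + 1) * (n + 1 + α) * (n + 1 + β) - n * (n + α) * (n + β)

/-- The partial numerator `-2 n (n + α) (n + β) (n + γ)`. -/
noncomputable def partNum (α β γ : ℂ) (n : ℕ) : ℂ :=
  -2 * n * (n + α) * (n + β) * (n + γ)

/-- `X` satisfies the three-term recurrence `X (n + 1) = a n * X n + b n * X (n - 1)`, `n ≥ 1`,
of the numerators and denominators of the convergents. -/
def IsSolution (α β γ : ℂ) (X : ℕ → ℂ) : Prop :=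
  ∀ n, X (n + 2) = partDen α β (n + 1) * X (n + 1) + partNum α β γ (n + 1) * X n

/-- The solution of the recurrence with initial values `x` and `y`. -/
noncomputable def solution (α β γ x y : ℂ) : ℕ → ℂ
  | 0 => x
  | 1 => y
  | n + 2 => partDen α β (n + 1) * solution α β γ x y (n + 1) +
      partNum α β γ (n + 1) * solution α β γ x y n

/-- The numerators of the convergents, indexed so that `A 0 = 1` and `A 1 = a 0`. -/
noncomputable def cfNum (α β γ : ℂ) : ℕ → ℂ := solution α β γ 1 (partDen α β 0)

/-- The denominators of the convergents, indexed so that `B 0 = 0` and `B 1 = 1`. -/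
noncomputable def cfDen (α β γ : ℂ) : ℕ → ℂ := solution α β γ 0 1

theorem isSolution_solution (α β γ x y : ℂ) : IsSolution α β γ (solution α β γ x y) :=
  fun _ => by rw [solution]

theorem IsSolution.ext {α β γ : ℂ} {X Y : ℕ → ℂ} (hX : IsSolution α β γ X)
    (hY : IsSolution α β γ Y) (h0 : X 0 = Y 0) (h1 : X 1 = Y 1) (n : ℕ) : X n = Y n := by
  induction n using Nat.twoStepInduction with
  | zero => exact h0
  | one => exact h1
  | more n h h' => rw [hX, hY, h, h']

theorem IsSolution.sub_const_mul {α β γ : ℂ} {X Y : ℕ → ℂ} (hX : IsSolution α β γ X)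
    (hY : IsSolution α β γ Y) (c : ℂ) : IsSolution α β γ fun n => X n - c * Y n := by
  intro n
  simp only [hX n, hY n]
  ring

theorem poch_zero (x : ℂ) : poch x 0 = 1 := by simp [poch]

theorem poch_succ (x : ℂ) (n : ℕ) : poch x (n + 1) = poch x n * (x + n) := by
  simp [poch, ascPochhammer_succ_eval]

theorem poch_ne_zero {x : ℂ} (hx : ∀ m : ℕ, x ≠ -(m : ℂ)) (n : ℕ) : poch x n ≠ 0 := by
  induction n with
  | zero => simp [poch_zero]
  | succ n ih =>
    rw [poch_succ]
    exact mul_ne_zero ih fun h => hx n (eq_neg_of_add_eq_zero_left h)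

/-- The weight `(n + 2k)! / (2 ^ (n + 2k) k!)`. -/
noncomputable def weight (n k : ℕ) : ℝ := (n + 2 * k).factorial / (2 ^ (n + 2 * k) * k.factorial)

theorem weight_pos (n k : ℕ) : 0 < weight n k := by
  unfold weight
  positivity

theorem weight_succ_left (n k : ℕ) : weight (n + 1) k = weight n k * (n + 1 + 2 * k) / 2 := by
  have h : n + 1 + 2 * k = (n + 2 * k) + 1 := by ring
  have := Nat.factorial_ne_zero k
  simp only [weight, h, Nat.factorial_succ, pow_succ]
  push_cast
  field_simp
  ring

theorem weight_add_two_left (n k : ℕ) : weight (n + 2) k = (k + 1) * weight n (k + 1) := by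
  have h : n + 2 * (k + 1) = n + 2 + 2 * k := by ring
  have := Nat.factorial_ne_zero k
  simp only [weight, h, Nat.factorial_succ]
  push_cast
  field_simp

theorem weight_succ_right (n k : ℕ) :
    4 * (k + 1) * weight n (k + 1) = weight n k * (n + 1 + 2 * k) * (n + 2 + 2 * k) := by
  have h := weight_add_two_left n k
  rw [weight_succ_left, weight_succ_left] at h
  push_cast at h
  linear_combination -4 * h

theorem weight_zero_left (k : ℕ) : (weight 0 k : ℂ) = poch (1 / 2) k := by
  induction k with
  | zero => simp [weight, poch_zero]
  | succ k ih =>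
    have h := congrArg (fun x : ℝ => (x : ℂ)) (weight_succ_right 0 k)
    push_cast at h
    have hk : (k : ℂ) + 1 ≠ 0 := Nat.cast_add_one_ne_zero k
    rw [poch_succ, ← ih]
    apply mul_left_cancel₀ hk
    linear_combination h / 4

theorem weight_le (n k : ℕ) : weight n k ≤ weight 0 (n + k) := by
  induction n with
  | zero => simp
  | succ n ih =>
    have h := weight_succ_right 0 (n + k)
    have h2 : weight 0 (n + k + 1) = weight 0 (n + k) * (2 * (n + k) + 1) / 2 := by
      have hk : (n : ℝ) + k + 1 ≠ 0 := by positivity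
      apply mul_left_cancel₀ hk
      push_cast at h
      linear_combination h / 4
    rw [weight_succ_left, show n + 1 + k = n + k + 1 by ring, h2]
    have := weight_pos n k
    gcongr ?_ / 2
    apply mul_le_mul ih ?_ (by positivity) (weight_pos _ _).le
    have : (0 : ℝ) ≤ n := n.cast_nonneg
    linarith

/-- The factor `(γ + 1)_j / (((α + 1) / 2)_{j + 1} ((β + 1) / 2)_{j + 1})`, so that the series of
the theorem is `∑ (1 / 2)_j * pochQuot α β γ j`. -/
noncomputable def pochQuot (α β γ : ℂ) (j : ℕ) : ℂ :=
  poch (γ + 1) j / (poch ((α + 1) / 2) (j + 1) * poch ((β + 1) / 2) (j + 1))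

/-- The summand `weight n k * pochQuot (n + k)`. For `n = 0` it is the summand of the series in
the theorem; summed over `k` it gives, up to an explicit factor, the small solution. -/
noncomputable def tailTerm (α β γ : ℂ) (n k : ℕ) : ℂ := weight n k * pochQuot α β γ (n + k)

theorem tailTerm_zero_left (α β γ : ℂ) (k : ℕ) : tailTerm α β γ 0 k =
    poch (1 / 2) k * poch (γ + 1) k / (poch ((α + 1) / 2) (k + 1) * poch ((β + 1) / 2) (k + 1)) := by
  rw [tailTerm, weight_zero_left, zero_add, pochQuot, mul_div_assoc]

theorem tailTerm_one_left (α β γ : ℂ) (k : ℕ) : tailTerm α β γ 1 k = tailTerm α β γ 0 (k + 1) := by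
  have h := weight_succ_right 0 k
  have h' := weight_succ_left 0 k
  have hk : (k : ℝ) + 1 ≠ 0 := by positivity
  rw [tailTerm, tailTerm, add_comm 1 k, zero_add]
  congr 2
  apply mul_left_cancel₀ hk
  push_cast at h h'
  simp only [zero_add] at h'
  linear_combination (k + 1) * h' - h / 4

theorem norm_tailTerm_le (α β γ : ℂ) (n k : ℕ) :
    ‖tailTerm α β γ n k‖ ≤ ‖tailTerm α β γ 0 (n + k)‖ := by
  simp only [tailTerm, norm_mul, zero_add, Complex.norm_real]
  gcongr
  rw [Real.norm_of_nonneg (weight_pos _ _).le, Real.norm_of_nonneg (weight_pos _ _).le]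
  exact weight_le n k

theorem pochQuot_succ {α β γ : ℂ} (hα : ∀ m : ℕ, (α + 1) / 2 ≠ -(m : ℂ))
    (hβ : ∀ m : ℕ, (β + 1) / 2 ≠ -(m : ℂ)) (j : ℕ) :
    4 * (j + 1 + γ) * pochQuot α β γ j =
    (2 * j + 3 + α) * (2 * j + 3 + β) * pochQuot α β γ (j + 1) := by
  have h1 := poch_ne_zero hα (j + 1)
  have h2 := poch_ne_zero hβ (j + 1)
  have h3 := poch_ne_zero hα (j + 2)
  have h4 := poch_ne_zero hβ (j + 2)
  rw [poch_succ] at h3 h4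
  have h5 := right_ne_zero_of_mul h3
  have h6 := right_ne_zero_of_mul h4
  simp only [pochQuot]
  rw [poch_succ (γ + 1) j, poch_succ ((α + 1) / 2) (j + 1), poch_succ ((β + 1) / 2) (j + 1)]
  push_cast at h5 h6 ⊢
  rw [show (2 * (j : ℂ) + 3 + α) = 2 * ((α + 1) / 2 + (j + 1)) by ring,
    show (2 * (j : ℂ) + 3 + β) = 2 * ((β + 1) / 2 + (j + 1)) by ring]
  generalize (α + 1) / 2 + ((j : ℂ) + 1) = u at *
  generalize (β + 1) / 2 + ((j : ℂ) + 1) = v at *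
  field_simp
  ring

/-- Creative telescoping: applying the recurrence to the summands `tailTerm` gives a telescoping
sum. -/
theorem sum_tailTerm_recurrence {α β γ : ℂ} (hα : ∀ m : ℕ, (α + 1) / 2 ≠ -(m : ℂ))
    (hβ : ∀ m : ℕ, (β + 1) / 2 ≠ -(m : ℂ)) (n K : ℕ) :
    (n + 2 + α) * (n + 2 + β) * ∑ k ∈ Finset.range K, tailTerm α β γ (n + 2) k
      - partDen α β (n + 1) * ∑ k ∈ Finset.range (K + 1), tailTerm α β γ (n + 1) k
      + 2 * (n + 1) * (n + 1 + γ) * ∑ k ∈ Finset.range (K + 2), tailTerm α β γ n k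
    = 2 * (n + 1) * (n + K + 2 + γ) * tailTerm α β γ n (K + 1) := by
  have key (k : ℕ) := congrArg (fun x : ℝ => (x : ℂ)) (weight_succ_right n k)
  have key1 (k : ℕ) := congrArg (fun x : ℝ => (x : ℂ)) (weight_succ_left n k)
  have key2 (k : ℕ) := congrArg (fun x : ℝ => (x : ℂ)) (weight_add_two_left n k)
  push_cast at key key1 key2
  induction K with
  | zero =>
    have h := pochQuot_succ (γ := γ) hα hβ n
    have a := key 0
    simp only [Finset.sum_range_succ, Finset.range_zero, Finset.sum_empty, tailTerm, key1, partDen,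
      zero_add, add_zero] at a h ⊢
    push_cast at a h ⊢
    linear_combination (n + 1) * weight n 0 / 2 * h +
      (-(n + 1) / 2 * pochQuot α β γ (n + 1)) * a
  | succ K ih =>
    rw [Finset.sum_range_succ, Finset.sum_range_succ _ (K + 1), Finset.sum_range_succ _ (K + 2)]
    have h := pochQuot_succ (γ := γ) hα hβ (n + K + 1)
    have a := key (K + 1)
    have e1 : n + 2 + K = n + K + 1 + 1 := by ring
    have e2 : n + 1 + (K + 1) = n + K + 1 + 1 := by ring
    have e3 : n + (K + 2) = n + K + 1 + 1 := by ring
    have e4 : n + (K + 1) = n + K + 1 := by ring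
    simp only [tailTerm, key1, key2, partDen, e1, e2, e3, e4] at ih a h ⊢
    push_cast at ih a h ⊢
    linear_combination ih + (n + 1) * weight n (K + 1) / 2 * h +
      (-(n + 1) / 2 * pochQuot α β γ (n + K + 1 + 1)) * a

/-! ### Convergence of the series -/

theorem poch_eq_prod (x : ℂ) (n : ℕ) : poch x n = ∏ j ∈ Finset.range n, (x + j) := by
  induction n with
  | zero => simp [poch_zero]
  | succ n ih => rw [poch_succ, ih, Finset.prod_range_succ]

theorem GammaSeq_mul_poch {x : ℂ} (hx : ∀ m : ℕ, x ≠ -(m : ℂ)) (n : ℕ) :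
    Complex.GammaSeq x n * (poch x n * (x + n)) = (n : ℂ) ^ x * n.factorial := by
  have h := poch_ne_zero hx (n + 1)
  rw [← poch_succ, Complex.GammaSeq, ← poch_eq_prod, div_mul_cancel₀ _ h]

/-- Since `n ^ x * n! / (x (x + 1) ⋯ (x + n))` tends to `Γ x`, the summand of the series is
`O(n ^ (Re (γ - (α + β) / 2) - 3 / 2))`. -/
theorem tailTerm_isBigO {α β γ : ℂ} (hα : ∀ m : ℕ, (α + 1) / 2 ≠ -(m : ℂ))
    (hβ : ∀ m : ℕ, (β + 1) / 2 ≠ -(m : ℂ)) (hγ : ∀ m : ℕ, γ + 1 ≠ -(m : ℂ)) :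
    (fun n : ℕ => tailTerm α β γ 0 n) =O[atTop]
      fun n : ℕ => (n : ℝ) ^ ((γ + 1 / 2 - (α + β) / 2).re - 2) := by
  have hh : ∀ m : ℕ, (1 / 2 : ℂ) ≠ -(m : ℂ) := by
    intro m h
    have := congrArg Complex.re h
    norm_num at this
    have hm : (0 : ℝ) ≤ m := m.cast_nonneg
    linarith
  set w := γ + 1 / 2 - (α + β) / 2 with hw
  have hlim := ((Complex.GammaSeq_tendsto_Gamma ((α + 1) / 2)).mul
    (Complex.GammaSeq_tendsto_Gamma ((β + 1) / 2))).div
    ((Complex.GammaSeq_tendsto_Gamma (1 / 2)).mul (Complex.GammaSeq_tendsto_Gamma (γ + 1)))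
    (mul_ne_zero (Complex.Gamma_ne_zero hh) (Complex.Gamma_ne_zero hγ))
  have h1 := (tendsto_natCast_div_add_atTop (1 / 2 : ℂ)).mul
    (tendsto_natCast_div_add_atTop (γ + 1))
  have h2 := (hlim.mul h1).norm
  refine Asymptotics.IsBigO.of_norm_left (Asymptotics.isBigO_of_div_tendsto_nhds ?_ _
    (h2.congr' ?_))
  · filter_upwards [eventually_gt_atTop 0] with n hn h
    have : (0 : ℝ) < n := Nat.cast_pos.2 hn
    exact absurd h (Real.rpow_pos_of_pos this _).ne'
  · filter_upwards [eventually_gt_atTop 0] with n hn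
    have hn0 : (n : ℂ) ≠ 0 := Nat.cast_ne_zero.2 hn.ne'
    have hnr : (0 : ℝ) < n := Nat.cast_pos.2 hn
    have e1 := GammaSeq_mul_poch hα n
    have e2 := GammaSeq_mul_poch hβ n
    have e3 := GammaSeq_mul_poch hh n
    have e4 := GammaSeq_mul_poch hγ n
    have hf : (n.factorial : ℂ) ≠ 0 := Nat.cast_ne_zero.2 n.factorial_ne_zero
    have p1 := poch_ne_zero hα (n + 1)
    have p2 := poch_ne_zero hβ (n + 1)
    have p3 := poch_ne_zero hh (n + 1)
    have p4 := poch_ne_zero hγ (n + 1)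
    have hpow (x : ℂ) : (n : ℂ) ^ x ≠ 0 := by simp [Complex.cpow_eq_zero_iff, hn0]
    have q3 : Complex.GammaSeq (1 / 2) n ≠ 0 :=
      left_ne_zero_of_mul (e3 ▸ mul_ne_zero (hpow _) hf)
    have q4 : Complex.GammaSeq (γ + 1) n ≠ 0 :=
      left_ne_zero_of_mul (e4 ▸ mul_ne_zero (hpow _) hf)
    have hc : (n : ℂ) ^ ((1 / 2 : ℂ)) * (n : ℂ) ^ (γ + 1) =
        (n : ℂ) ^ w * ((n : ℂ) ^ ((α + 1) / 2) * (n : ℂ) ^ ((β + 1) / 2)) := by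
      rw [← Complex.cpow_add _ _ hn0, ← Complex.cpow_add _ _ hn0, ← Complex.cpow_add _ _ hn0, hw]
      congr 1
      ring
    have hr : (n : ℝ) ^ (w.re - 2) = ‖(n : ℂ) ^ w‖ / ‖(n : ℂ) ^ 2‖ := by
      rw [Complex.norm_natCast_cpow_of_pos hn, Real.rpow_sub hnr]
      simp
    simp only [Pi.div_apply]
    rw [hr, ← norm_div, ← norm_div, tailTerm_zero_left]
    congr 1
    rw [poch_succ] at p1 p2 p3 p4
    have r3 := right_ne_zero_of_mul p3
    have r4 := right_ne_zero_of_mul p4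
    have hw0 := hpow w
    have main : Complex.GammaSeq ((α + 1) / 2) n * Complex.GammaSeq ((β + 1) / 2) n * (n : ℂ) ^ w *
        (poch ((α + 1) / 2) n * ((α + 1) / 2 + n) * (poch ((β + 1) / 2) n * ((β + 1) / 2 + n))) =
        Complex.GammaSeq (1 / 2) n * Complex.GammaSeq (γ + 1) n * (poch (1 / 2) n * (1 / 2 + n) *
          (poch (γ + 1) n * (γ + 1 + n))) := by
      calc _ = (n : ℂ) ^ w * (Complex.GammaSeq ((α + 1) / 2) n *
            (poch ((α + 1) / 2) n * ((α + 1) / 2 + n))) * (Complex.GammaSeq ((β + 1) / 2) n *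
            (poch ((β + 1) / 2) n * ((β + 1) / 2 + n))) := by ring
        _ = (Complex.GammaSeq (1 / 2) n * (poch (1 / 2) n * (1 / 2 + n))) *
            (Complex.GammaSeq (γ + 1) n * (poch (γ + 1) n * (γ + 1 + n))) := by
          rw [e1, e2, e3, e4]
          linear_combination (-(n.factorial : ℂ) ^ 2) * hc
        _ = _ := by ring
    have r3' : (n : ℂ) + 1 / 2 ≠ 0 := by rwa [add_comm]
    have r4' : (n : ℂ) + (γ + 1) ≠ 0 := by rwa [add_comm]
    rw [← mul_div_mul_comm, div_mul_div_comm, div_div_div_eq, poch_succ, poch_succ,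
      div_eq_div_iff (mul_ne_zero (mul_ne_zero q3 q4) (mul_ne_zero r3' r4'))
        (mul_ne_zero (mul_ne_zero p1 p2) hw0)]
    linear_combination (n : ℂ) ^ 2 * main

/-! ### Growing and small solutions -/

theorem geometric_le {w : ℕ → ℝ} {r : ℝ} (hr : 0 < r) {N : ℕ}
    (h : ∀ n ≥ N, r * w n ≤ w (n + 1)) : ∀ n ≥ N, w N / r ^ N * r ^ n ≤ w n := by
  intro n hn
  induction n, hn using Nat.le_induction with
  | base => rw [div_mul_cancel₀ _ (pow_pos hr N).ne']
  | succ n hn ih =>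
    refine le_trans ?_ (h n hn)
    calc w N / r ^ N * r ^ (n + 1) = r * (w N / r ^ N * r ^ n) := by ring
      _ ≤ _ := by gcongr

theorem le_geometric {w : ℕ → ℝ} {r : ℝ} (hr : 0 < r) {N : ℕ}
    (h : ∀ n ≥ N, w (n + 1) ≤ r * w n) : ∀ n ≥ N, w n ≤ w N / r ^ N * r ^ n := by
  intro n hn
  have := geometric_le (w := fun n => -w n) hr (fun n hn => by linarith [h n hn]) n hn
  rw [neg_div] at this
  linarith

theorem not_eventually_geometric_le {a b c C : ℝ} (hb : 0 < b) (hab : b < a) (hc : 0 < c) :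
    ¬ ∀ᶠ n : ℕ in atTop, c * a ^ n ≤ C * b ^ n := by
  intro h
  have ha := hb.trans hab
  have h1 : Tendsto (fun n : ℕ => C * (b / a) ^ n) atTop (𝓝 (C * 0)) :=
    (tendsto_pow_atTop_nhds_zero_of_lt_one (by positivity) ((div_lt_one ha).2 hab)).const_mul C
  rw [mul_zero] at h1
  obtain ⟨n, hn1, hn2⟩ := (h.and (h1.eventually (gt_mem_nhds hc))).exists
  rw [div_pow, ← mul_div_assoc, div_lt_iff₀ (pow_pos ha n)] at hn2
  linarith

/-- A perturbation `Y (n + 2) = p n * Y (n + 1) - q n * Y n` of `Y (n + 2) = 3 Y (n + 1) - 2 Y n`,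
whose characteristic roots are `1` and `2`: every solution either grows at least geometrically with
ratio `7 / 5`, or is bounded by a geometric sequence of ratio `11 / 10`. -/
theorem grows_or_small_of_tendsto {p q Y : ℕ → ℂ} (hp : Tendsto p atTop (𝓝 3))
    (hq : Tendsto q atTop (𝓝 2)) (hY : ∀ n, Y (n + 2) = p n * Y (n + 1) - q n * Y n) :
    (∀ᶠ n in atTop, Y n ≠ 0 ∧ 7 / 5 * ‖Y n‖ ≤ ‖Y (n + 1)‖) ∨
      ∃ C, ∀ᶠ n in atTop, ‖Y n‖ ≤ C * (11 / 10 : ℝ) ^ n := by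
  -- `u` and `v` are the components of `Y` along the eigenvalues `2` and `1`.
  set u : ℕ → ℂ := fun n => Y (n + 1) - Y n with hu
  set v : ℕ → ℂ := fun n => Y (n + 1) - 2 * Y n with hv
  have hY0 (n : ℕ) : Y n = u n - v n := by simp only [hu, hv]; ring
  have hY1 (n : ℕ) : Y (n + 1) = 2 * u n - v n := by simp only [hu, hv]; ring
  obtain ⟨N, hN⟩ := eventually_atTop.1 ((hp.eventually (Metric.closedBall_mem_nhds 3
    (show (0 : ℝ) < 1 / 200 by norm_num))).and (hq.eventually (Metric.closedBall_mem_nhds 2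
    (show (0 : ℝ) < 1 / 200 by norm_num))))
  have hpert (n : ℕ) (hn : N ≤ n) (a b : ℂ) (ha : a = 2 * (p n - 3) - (q n - 2))
      (hb : b = (q n - 2) - (p n - 3)) :
      ‖a * u n + b * v n‖ ≤ 3 / 200 * ‖u n‖ + 2 / 200 * ‖v n‖ := by
    obtain ⟨h1, h2⟩ := hN n hn
    rw [dist_eq_norm] at h1 h2
    have h3 : ‖a‖ ≤ 3 / 200 := by
      rw [ha]
      refine (norm_sub_le _ _).trans ?_
      rw [norm_mul, Complex.norm_ofNat]
      linarith
    have h4 : ‖b‖ ≤ 2 / 200 := by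
      rw [hb]
      refine (norm_sub_le _ _).trans ?_
      linarith
    refine (norm_add_le _ _).trans ?_
    rw [norm_mul, norm_mul]
    gcongr
  have hu1 (n : ℕ) (hn : N ≤ n) : 2 * ‖u n‖ - (3 / 200 * ‖u n‖ + 2 / 200 * ‖v n‖) ≤ ‖u (n + 1)‖ := by
    have h := hpert n hn _ _ rfl rfl
    have e : u (n + 1) = 2 * u n + ((2 * (p n - 3) - (q n - 2)) * u n +
        ((q n - 2) - (p n - 3)) * v n) := by
      simp only [hu, hv, hY]
      ring
    have h2 := norm_sub_le_norm_add (2 * u n)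
      ((2 * (p n - 3) - (q n - 2)) * u n + ((q n - 2) - (p n - 3)) * v n)
    rw [norm_mul, Complex.norm_ofNat] at h2
    rw [e]
    linarith
  have hv1 (n : ℕ) (hn : N ≤ n) : ‖v (n + 1)‖ ≤ ‖v n‖ + (3 / 200 * ‖u n‖ + 2 / 200 * ‖v n‖) := by
    have h := hpert n hn _ _ rfl rfl
    have e : v (n + 1) = v n + ((2 * (p n - 3) - (q n - 2)) * u n +
        ((q n - 2) - (p n - 3)) * v n) := by
      simp only [hu, hv, hY]
      ring
    rw [e]
    exact (norm_add_le _ _).trans (by linarith)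
  by_cases hcone : ∃ n ≥ N, u n ≠ 0 ∧ 4 * ‖v n‖ ≤ ‖u n‖
  · -- The cone `4 ‖v‖ ≤ ‖u‖` is mapped into itself.
    left
    obtain ⟨n₀, hn₀, h₀⟩ := hcone
    filter_upwards [eventually_ge_atTop n₀] with n hn
    have hcone' : u n ≠ 0 ∧ 4 * ‖v n‖ ≤ ‖u n‖ := by
      induction n, hn using Nat.le_induction with
      | base => exact h₀
      | succ n hn ih =>
        have h1 := hu1 n (hn₀.trans hn)
        have h2 := hv1 n (hn₀.trans hn)
        have h3 := norm_pos_iff.2 ih.1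
        exact ⟨norm_pos_iff.1 (by linarith [ih.2]), by linarith [ih.2]⟩
    have h3 := norm_pos_iff.2 hcone'.1
    have h4 := norm_sub_norm_le (u n) (v n)
    have h5 := norm_sub_le (u n) (v n)
    have h6 := norm_sub_norm_le (2 * u n) (v n)
    rw [norm_mul, Complex.norm_ofNat] at h6
    rw [hY1, hY0]
    exact ⟨norm_pos_iff.1 (by linarith [hcone'.2]), by linarith [hcone'.2]⟩
  · right
    have hout (n : ℕ) (hn : N ≤ n) : ‖u n‖ ≤ 4 * ‖v n‖ := by
      by_contra hlt
      have := norm_nonneg (v n)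
      exact hcone ⟨n, hn, norm_pos_iff.1 (by linarith), by linarith⟩
    have hgeo := le_geometric (w := fun n => ‖v n‖) (r := 11 / 10) (by norm_num) (N := N)
      fun n hn => by linarith [hv1 n hn, hout n hn, norm_nonneg (v n)]
    refine ⟨5 * (‖v N‖ / (11 / 10) ^ N), ?_⟩
    filter_upwards [eventually_ge_atTop N] with n hn
    rw [hY0]
    refine (norm_sub_le _ _).trans ?_
    linarith [hgeo n hn, hout n hn]

/-- From some index on `X` has no zero and `‖X (n + 1)‖ ≥ ρ (n + 1)² ‖X n‖`. -/
def GrowsAt (ρ : ℝ) (X : ℕ → ℂ) : Prop :=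
  ∀ᶠ n : ℕ in atTop, X n ≠ 0 ∧ ρ * (n + 1) ^ 2 * ‖X n‖ ≤ ‖X (n + 1)‖

/-- `X n` is at most a constant times `(11 / 10) ^ n * n!²`. -/
def IsSmall (X : ℕ → ℂ) : Prop :=
  ∃ C : ℝ, ∀ᶠ n : ℕ in atTop, ‖X n‖ ≤ C * (11 / 10) ^ n * (n.factorial : ℝ) ^ 2

theorem tendsto_partDen_div (α β : ℂ) :
    Tendsto (fun n : ℕ => partDen α β (n + 1) / ((n : ℂ) + 2) ^ 2) atTop (𝓝 3) := by
  have h : Tendsto (fun n : ℕ => ((n : ℂ) + 2)⁻¹) atTop (𝓝 0) := by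
    have := (tendsto_inv_atTop_nhds_zero_nat (𝕜 := ℂ)).comp (tendsto_add_atTop_nat 2)
    simpa [Function.comp_def] using this
  have h2 := ((h.const_mul (2 * (α + β) - 3)).const_add 3).add
    ((h.pow 2).const_mul (1 - (α + β) + α * β))
  simp only [mul_zero, add_zero, ne_eq, OfNat.ofNat_ne_zero, not_false_eq_true, zero_pow] at h2
  refine h2.congr fun n => ?_
  have hn : (n : ℂ) + 2 ≠ 0 := by exact_mod_cast (Nat.succ_ne_zero (n + 1))
  rw [partDen]
  field_simp
  push_cast
  ring

theorem tendsto_partNum_div (α β γ : ℂ) :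
    Tendsto (fun n : ℕ => -partNum α β γ (n + 1) / (((n : ℂ) + 2) ^ 2 * ((n : ℂ) + 1) ^ 2))
      atTop (𝓝 2) := by
  have h : Tendsto (fun n : ℕ => ((n : ℂ) + 2)⁻¹) atTop (𝓝 0) := by
    have := (tendsto_inv_atTop_nhds_zero_nat (𝕜 := ℂ)).comp (tendsto_add_atTop_nat 2)
    simpa [Function.comp_def] using this
  have h' : Tendsto (fun n : ℕ => ((n : ℂ) + 1)⁻¹) atTop (𝓝 0) := by
    have := (tendsto_inv_atTop_nhds_zero_nat (𝕜 := ℂ)).comp (tendsto_add_atTop_nat 1)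
    simpa [Function.comp_def] using this
  have h2 := ((((h.const_mul (α - 1)).const_add 1).mul ((h.const_mul (β - 1)).const_add 1)).mul
    ((h'.const_mul γ).const_add 1)).const_mul 2
  simp only [mul_zero, add_zero, mul_one] at h2
  refine h2.congr fun n => ?_
  have hn : (n : ℂ) + 2 ≠ 0 := by exact_mod_cast (Nat.succ_ne_zero (n + 1))
  have hn1 : (n : ℂ) + 1 ≠ 0 := by exact_mod_cast (Nat.succ_ne_zero n)
  rw [partNum]
  field_simp
  push_cast
  ring

theorem IsSolution.grows_or_small {α β γ : ℂ} {X : ℕ → ℂ} (hX : IsSolution α β γ X) :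
    GrowsAt (7 / 5) X ∨ IsSmall X := by
  have hf (n : ℕ) : (n.factorial : ℂ) ≠ 0 := Nat.cast_ne_zero.2 n.factorial_ne_zero
  have hfr (n : ℕ) : (0 : ℝ) < (n.factorial : ℝ) ^ 2 := by positivity
  have hn1 (n : ℕ) : (n : ℂ) + 1 ≠ 0 := by exact_mod_cast (Nat.succ_ne_zero n)
  have hn2 (n : ℕ) : (n : ℂ) + 2 ≠ 0 := by exact_mod_cast (Nat.succ_ne_zero (n + 1))
  have hnorm (n : ℕ) : ‖X n / (n.factorial : ℂ) ^ 2‖ = ‖X n‖ / (n.factorial : ℝ) ^ 2 := by simp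
  rcases grows_or_small_of_tendsto (Y := fun n => X n / (n.factorial : ℂ) ^ 2)
    (tendsto_partDen_div α β) (tendsto_partNum_div α β γ) (fun n => by
      have := hf n
      have := hn1 n
      have := hn2 n
      simp only [hX n, Nat.factorial_succ]
      push_cast
      rw [show (n : ℂ) + 1 + 1 = n + 2 by ring]
      field_simp
      ring) with h | ⟨C, h⟩
  · left
    filter_upwards [h] with n hn
    refine ⟨fun h0 => hn.1 (by simp [h0]), ?_⟩
    have h2 := hn.2
    rw [hnorm, hnorm, Nat.factorial_succ] at h2
    push_cast at h2
    have := hfr n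
    rw [← mul_div_assoc, mul_pow, div_le_div_iff₀ (hfr n) (by positivity)] at h2
    have h3 : (n.factorial : ℝ) ^ 2 * (7 / 5 * (n + 1) ^ 2 * ‖X n‖) ≤
        (n.factorial : ℝ) ^ 2 * ‖X (n + 1)‖ := by linarith
    exact le_of_mul_le_mul_left h3 this
  · right
    refine ⟨C, ?_⟩
    filter_upwards [h] with n hn
    rwa [hnorm, div_le_iff₀ (hfr n)] at hn

theorem IsSmall.add_const_mul {X Y : ℕ → ℂ} (hX : IsSmall X) (hY : IsSmall Y) (c : ℂ) :
    IsSmall fun n => X n + c * Y n := by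
  obtain ⟨C, hC⟩ := hX
  obtain ⟨D, hD⟩ := hY
  refine ⟨C + ‖c‖ * D, ?_⟩
  filter_upwards [hC, hD] with n h1 h2
  refine (norm_add_le _ _).trans ?_
  rw [norm_mul]
  calc ‖X n‖ + ‖c‖ * ‖Y n‖ ≤ C * (11 / 10) ^ n * (n.factorial : ℝ) ^ 2 +
      ‖c‖ * (D * (11 / 10) ^ n * (n.factorial : ℝ) ^ 2) := by gcongr
    _ = _ := by ring

/-- A small solution is negligible with respect to a growing one. -/
theorem IsSmall.tendsto_div {X Y : ℕ → ℂ} (hX : IsSmall X) (hY : GrowsAt (13 / 10) Y) :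
    Tendsto (fun n => X n / Y n) atTop (𝓝 0) := by
  obtain ⟨C, hC⟩ := hX
  obtain ⟨N, hN⟩ := eventually_atTop.1 hY
  have hfr (n : ℕ) : (0 : ℝ) < (n.factorial : ℝ) ^ 2 := by positivity
  have hgeo := geometric_le (w := fun n => ‖Y n‖ / (n.factorial : ℝ) ^ 2) (r := 13 / 10)
    (by norm_num) (N := N) fun n hn => by
      have h := (hN n hn).2
      rw [Nat.factorial_succ, ← mul_div_assoc, div_le_div_iff₀ (hfr n) (by positivity)]
      push_cast
      calc _ = (n.factorial : ℝ) ^ 2 * (13 / 10 * (n + 1) ^ 2 * ‖Y n‖) := by ring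
        _ ≤ (n.factorial : ℝ) ^ 2 * ‖Y (n + 1)‖ := by gcongr
        _ = _ := by ring
  set c := ‖Y N‖ / (N.factorial : ℝ) ^ 2 / (13 / 10) ^ N with hc
  have hc0 : 0 < c := div_pos (div_pos (norm_pos_iff.2 (hN N le_rfl).1) (hfr N)) (by positivity)
  have hlim : Tendsto (fun n : ℕ => C / c * ((11 / 10) / (13 / 10) : ℝ) ^ n) atTop (𝓝 0) := by
    have := (tendsto_pow_atTop_nhds_zero_of_lt_one (r := ((11 / 10) / (13 / 10) : ℝ))
      (by norm_num) (by norm_num)).const_mul (C / c)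
    rwa [mul_zero] at this
  refine squeeze_zero_norm' ?_ hlim
  filter_upwards [hC, eventually_ge_atTop N] with n h1 hn
  have h2 := hgeo n hn
  have h3 : 0 < ‖Y n‖ := norm_pos_iff.2 (hN n hn).1
  rw [le_div_iff₀ (hfr n)] at h2
  have h4 : 0 ≤ C * (11 / 10) ^ n := by
    by_contra hneg
    have := mul_neg_of_neg_of_pos (not_le.1 hneg) (hfr n)
    linarith [norm_nonneg (X n)]
  rw [norm_div, div_pow, div_mul_div_comm, div_le_div_iff₀ h3 (by positivity)]
  calc ‖X n‖ * (c * (13 / 10) ^ n) ≤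
      C * (11 / 10) ^ n * (n.factorial : ℝ) ^ 2 * (c * (13 / 10) ^ n) := by gcongr
    _ = C * (11 / 10) ^ n * (c * (13 / 10) ^ n * (n.factorial : ℝ) ^ 2) := by ring
    _ ≤ _ := by gcongr

theorem GrowsAt.not_isSmall {X : ℕ → ℂ} (hX : GrowsAt (13 / 10) X) : ¬ IsSmall X := by
  intro h
  have h1 : Tendsto (fun n => X n / X n) atTop (𝓝 1) :=
    tendsto_const_nhds.congr' (hX.mono fun n hn => (div_self hn.1).symm)
  exact zero_ne_one (tendsto_nhds_unique (h.tendsto_div hX) h1)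

theorem GrowsAt.mono {X : ℕ → ℂ} {ρ σ : ℝ} (h : ρ ≤ σ) (hX : GrowsAt σ X) : GrowsAt ρ X := by
  filter_upwards [hX] with n hn
  exact ⟨hn.1, le_trans (by gcongr) hn.2⟩

theorem IsSolution.casoratian_succ {α β γ : ℂ} {X Y : ℕ → ℂ} (hX : IsSolution α β γ X)
    (hY : IsSolution α β γ Y) (n : ℕ) :
    X (n + 2) * Y (n + 1) - X (n + 1) * Y (n + 2) =
      -partNum α β γ (n + 1) * (X (n + 1) * Y n - X n * Y (n + 1)) := by
  rw [hX, hY]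
  ring

theorem IsSolution.casoratian_ne_zero {α β γ : ℂ} {X Y : ℕ → ℂ} (hX : IsSolution α β γ X)
    (hY : IsSolution α β γ Y) (h0 : X 1 * Y 0 - X 0 * Y 1 ≠ 0) (n : ℕ)
    (hb : ∀ k < n, partNum α β γ (k + 1) ≠ 0) : X (n + 1) * Y n - X n * Y (n + 1) ≠ 0 := by
  induction n with
  | zero => exact h0
  | succ n ih =>
    rw [hX.casoratian_succ hY]
    exact mul_ne_zero (neg_ne_zero.2 (hb n n.lt_succ_self))
      (ih fun k hk => hb k (hk.trans n.lt_succ_self))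

/-- Two independent solutions are not both small, because their Casoratian grows like `2 ^ n`
after normalization. -/
theorem IsSolution.not_isSmall_of_isSmall {α β γ : ℂ} {X Y : ℕ → ℂ} (hX : IsSolution α β γ X)
    (hY : IsSolution α β γ Y) (h0 : X 1 * Y 0 - X 0 * Y 1 ≠ 0)
    (hb : ∀ k, partNum α β γ (k + 1) ≠ 0) (hsX : IsSmall X) : ¬ IsSmall Y := by
  intro hsY
  have hW (n : ℕ) := hX.casoratian_ne_zero hY h0 n fun k _ => hb k
  obtain ⟨C, hC⟩ := hsX
  obtain ⟨D, hD⟩ := hsY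
  have hq := (tendsto_partNum_div α β γ).norm.eventually (lt_mem_nhds
    (show (13 / 10 : ℝ) < ‖(2 : ℂ)‖ by rw [Complex.norm_ofNat]; norm_num))
  obtain ⟨N, hN⟩ := eventually_atTop.1 hq
  have hF (n : ℕ) : (0 : ℝ) < (n.factorial : ℝ) ^ 2 * ((n + 1).factorial : ℝ) ^ 2 := by positivity
  have hgeo := geometric_le (w := fun n => ‖X (n + 1) * Y n - X n * Y (n + 1)‖ /
    ((n.factorial : ℝ) ^ 2 * ((n + 1).factorial : ℝ) ^ 2)) (r := 13 / 10)
    (by norm_num) (N := N) fun n hn => by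
      have h := (hN n hn).le
      have e : ‖((n : ℂ) + 2) ^ 2 * ((n : ℂ) + 1) ^ 2‖ = ((n : ℝ) + 2) ^ 2 * ((n : ℝ) + 1) ^ 2 := by
        have e2 : ‖(n : ℂ) + 2‖ = (n : ℝ) + 2 := by exact_mod_cast Complex.norm_natCast (n + 2)
        have e1 : ‖(n : ℂ) + 1‖ = (n : ℝ) + 1 := by exact_mod_cast Complex.norm_natCast (n + 1)
        rw [norm_mul, norm_pow, norm_pow, e1, e2]
      rw [norm_div, e, le_div_iff₀ (by positivity)] at h
      rw [hX.casoratian_succ hY, norm_mul, ← mul_div_assoc, div_le_div_iff₀ (hF n) (hF _)]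
      have hf : (((n + 1 + 1).factorial : ℕ) : ℝ) = (n + 2) * (n + 1) * n.factorial := by
        rw [Nat.factorial_succ, Nat.factorial_succ]
        push_cast
        ring
      have hf1 : (((n + 1).factorial : ℕ) : ℝ) = (n + 1) * n.factorial := by
        rw [Nat.factorial_succ]
        push_cast
        ring
      rw [hf]
      set F := ((n + 1).factorial : ℝ)
      set G := ‖X (n + 1) * Y n - X n * Y (n + 1)‖
      calc _ = (13 / 10 * (((n : ℝ) + 2) ^ 2 * ((n : ℝ) + 1) ^ 2)) *
            (G * ((n.factorial : ℝ) ^ 2 * F ^ 2)) := by ring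
        _ ≤ ‖-partNum α β γ (n + 1)‖ * (G * ((n.factorial : ℝ) ^ 2 * F ^ 2)) := by gcongr
        _ = _ := by ring
  set c := ‖X (N + 1) * Y N - X N * Y (N + 1)‖ /
    ((N.factorial : ℝ) ^ 2 * ((N + 1).factorial : ℝ) ^ 2) / (13 / 10) ^ N
  have hc : 0 < c := div_pos (div_pos (norm_pos_iff.2 (hW N)) (hF N)) (by positivity)
  refine not_eventually_geometric_le (a := 13 / 10) (b := 121 / 100) (C := 22 / 10 * (C * D))
    (by norm_num) (by norm_num) hc ?_
  filter_upwards [hC, hD, (tendsto_add_atTop_nat 1).eventually hC,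
    (tendsto_add_atTop_nat 1).eventually hD, eventually_ge_atTop N] with n c0 d0 c1 d1 hn
  refine (hgeo n hn).trans ?_
  rw [div_le_iff₀ (hF n)]
  refine (norm_sub_le _ _).trans ?_
  rw [norm_mul, norm_mul]
  have m1 := mul_le_mul c1 d0 (norm_nonneg _) ((norm_nonneg _).trans c1)
  have m2 := mul_le_mul c0 d1 (norm_nonneg _) ((norm_nonneg _).trans c0)
  refine (add_le_add m1 m2).trans_eq ?_
  rw [show (121 / 100 : ℝ) = (11 / 10) ^ 2 by norm_num, ← pow_mul]
  ring

/-! ### The small solution as a combination of numerators and denominators -/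

/-- The hypotheses of the theorem on the parameters. -/
structure Admissible (α β γ : ℂ) : Prop where
  re_lt : (2 * γ - α - β).re < 1
  left : ∀ m : ℕ, (α + 1) / 2 ≠ -(m : ℂ)
  right : ∀ m : ℕ, (β + 1) / 2 ≠ -(m : ℂ)
  bot : ∀ m : ℕ, γ + 1 ≠ -(m : ℂ)

namespace Admissible

variable {α β γ : ℂ}

theorem symm (h : Admissible α β γ) : Admissible β α γ :=
  ⟨by rw [sub_right_comm]; exact h.re_lt, h.right, h.left, h.bot⟩

theorem summable_zero (h : Admissible α β γ) : Summable (tailTerm α β γ 0) := by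
  refine summable_of_isBigO_nat (Real.summable_nat_rpow.2 ?_) (tailTerm_isBigO h.left h.right h.bot)
  have := h.re_lt
  simp only [Complex.sub_re, Complex.add_re, Complex.mul_re, Complex.div_ofNat_re, Complex.one_re,
    Complex.re_ofNat, Complex.im_ofNat, zero_mul, sub_zero] at this ⊢
  linarith

theorem summable_norm (h : Admissible α β γ) (n : ℕ) : Summable fun k => ‖tailTerm α β γ n k‖ :=
  Summable.of_nonneg_of_le (fun _ => norm_nonneg _) (fun k => norm_tailTerm_le α β γ n k)
    (((summable_nat_add_iff n).2 h.summable_zero.norm).congr fun k => by rw [add_comm])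

theorem tsum_norm_le (h : Admissible α β γ) (n : ℕ) :
    ∑' k, ‖tailTerm α β γ n k‖ ≤ ∑' k, ‖tailTerm α β γ 0 k‖ := by
  refine (h.summable_norm n).tsum_le_tsum_of_inj (fun k => n + k)
    (add_right_injective n) (fun _ _ => norm_nonneg _)
    (fun k => norm_tailTerm_le α β γ n k) (h.summable_norm 0)

theorem tendsto_mul_tailTerm (h : Admissible α β γ) (c : ℂ) :
    Tendsto (fun j : ℕ => (j + c) * tailTerm α β γ 0 j) atTop (𝓝 0) := by
  have h1 : Tendsto (fun j : ℕ => (j : ℂ) * tailTerm α β γ 0 j) atTop (𝓝 0) := by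
    set w := (γ + 1 / 2 - (α + β) / 2).re - 2 with hw
    have hO : (fun j : ℕ => (j : ℂ) * tailTerm α β γ 0 j) =O[atTop]
        fun j : ℕ => (j : ℝ) * (j : ℝ) ^ w := by
      refine Asymptotics.IsBigO.mul (Asymptotics.IsBigO.of_bound 1 ?_)
        (tailTerm_isBigO h.left h.right h.bot)
      filter_upwards with n
      simp
    refine hO.trans_tendsto ?_
    have hneg : 0 < -(w + 1) := by
      have := h.re_lt
      rw [hw]
      simp only [Complex.sub_re, Complex.add_re, Complex.mul_re, Complex.div_ofNat_re,
        Complex.one_re, Complex.re_ofNat, Complex.im_ofNat, zero_mul, sub_zero] at this ⊢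
      linarith
    refine ((tendsto_rpow_neg_atTop hneg).comp tendsto_natCast_atTop_atTop).congr' ?_
    filter_upwards [eventually_gt_atTop 0] with n hn
    have : (0 : ℝ) < n := Nat.cast_pos.2 hn
    rw [Function.comp_apply, neg_neg, Real.rpow_add_one this.ne', mul_comm]
  have h2 := h1.add (h.summable_zero.tendsto_atTop_zero.const_mul c)
  rw [mul_zero, add_zero] at h2
  exact h2.congr fun j => by ring

theorem tsum_recurrence (h : Admissible α β γ) (n : ℕ) :
    (n + 2 + α) * (n + 2 + β) * ∑' k, tailTerm α β γ (n + 2) k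
      - partDen α β (n + 1) * ∑' k, tailTerm α β γ (n + 1) k
      + 2 * (n + 1) * (n + 1 + γ) * ∑' k, tailTerm α β γ n k = 0 := by
  have hs (n : ℕ) := (h.summable_norm n).of_norm.hasSum.tendsto_sum_nat
  have h1 := (((hs (n + 2)).const_mul ((n + 2 + α) * (n + 2 + β))).sub
    (((hs (n + 1)).comp (tendsto_add_atTop_nat 1)).const_mul (partDen α β (n + 1)))).add
    (((hs n).comp (tendsto_add_atTop_nat 2)).const_mul (2 * (n + 1) * (n + 1 + γ)))
  refine tendsto_nhds_unique (h1.congr fun K => sum_tailTerm_recurrence h.left h.right n K) ?_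
  have h2 := (((h.tendsto_mul_tailTerm (1 + γ)).comp (tendsto_add_atTop_nat (n + 1))).norm).const_mul
    ‖2 * ((n : ℂ) + 1)‖
  rw [norm_zero, mul_zero] at h2
  refine squeeze_zero_norm (fun K => ?_) h2
  rw [mul_assoc (2 * ((n : ℂ) + 1)), norm_mul, Function.comp_apply, norm_mul (_ + γ), norm_mul (_ + _)]
  have e : n + (K + 1) = K + (n + 1) := by ring
  have := e ▸ norm_tailTerm_le α β γ n (K + 1)
  rw [show ((K + (n + 1) : ℕ) : ℂ) + (1 + γ) = n + K + 2 + γ by push_cast; ring]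
  gcongr

end Admissible

/-- The explicit small solution of the recurrence. -/
noncomputable def smallSolution (α β γ : ℂ) (n : ℕ) : ℂ :=
  -1 / 4 * (poch (α + 1) n * poch (β + 1) n) * ∑' k, tailTerm α β γ n k

namespace Admissible

variable {α β γ : ℂ}

theorem isSolution_smallSolution (h : Admissible α β γ) :
    IsSolution α β γ (smallSolution α β γ) := by
  intro n
  have := h.tsum_recurrence n
  simp only [smallSolution, poch_succ, partNum]
  push_cast
  linear_combination (-1 / 4 * (poch (α + 1) n * poch (β + 1) n) * (α + 1 + n) * (β + 1 + n)) * this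

theorem isSmall_smallSolution (h : Admissible α β γ) : IsSmall (smallSolution α β γ) := by
  have hlim (x : ℂ) : Tendsto (fun n : ℕ => (x + 1 + n) / ((n : ℂ) + 1)) atTop (𝓝 1) := by
    have := ((tendsto_one_div_add_atTop_nhds_zero_nat (𝕜 := ℂ)).const_mul x).const_add 1
    rw [mul_zero, add_zero] at this
    refine this.congr fun n => ?_
    have hn : (n : ℂ) + 1 ≠ 0 := Nat.cast_add_one_ne_zero n
    field_simp
    ring
  have h1 := ((hlim α).mul (hlim β)).norm
  rw [mul_one, norm_one] at h1
  obtain ⟨N, hN⟩ := eventually_atTop.1 (h1.eventually (gt_mem_nhds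
    (show (1 : ℝ) < 11 / 10 by norm_num)))
  have hfr (n : ℕ) : (0 : ℝ) < (n.factorial : ℝ) ^ 2 := by positivity
  have hgeo := le_geometric (w := fun n => ‖poch (α + 1) n * poch (β + 1) n‖ /
    (n.factorial : ℝ) ^ 2) (r := 11 / 10) (by norm_num) (N := N) fun n hn => by
      have h2 := (hN n hn).le
      have e : ‖(n : ℂ) + 1‖ = (n : ℝ) + 1 := by exact_mod_cast Complex.norm_natCast (n + 1)
      rw [← mul_div_mul_comm, norm_div, norm_mul ((n : ℂ) + 1), e,
        div_le_iff₀ (by positivity)] at h2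
      rw [poch_succ, poch_succ, mul_mul_mul_comm, norm_mul (poch (α + 1) n * poch (β + 1) n),
        Nat.factorial_succ, ← mul_div_assoc, div_le_div_iff₀ (by positivity) (hfr n)]
      push_cast
      set G := ‖poch (α + 1) n * poch (β + 1) n‖
      calc _ ≤ G * (11 / 10 * (((n : ℝ) + 1) * (n + 1))) * (n.factorial : ℝ) ^ 2 := by gcongr
        _ = _ := by ring
  refine ⟨1 / 4 * (‖poch (α + 1) N * poch (β + 1) N‖ / (N.factorial : ℝ) ^ 2 / (11 / 10) ^ N) *
    ∑' k, ‖tailTerm α β γ 0 k‖, ?_⟩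
  filter_upwards [eventually_ge_atTop N] with n hn
  have h2 := hgeo n hn
  rw [div_le_iff₀ (hfr n)] at h2
  rw [smallSolution, norm_mul, norm_mul]
  have e : ‖(-1 / 4 : ℂ)‖ = 1 / 4 := by norm_num
  rw [e]
  have h3 : ‖∑' k, tailTerm α β γ n k‖ ≤ ∑' k, ‖tailTerm α β γ 0 k‖ :=
    (norm_tsum_le_tsum_norm (h.summable_norm n)).trans (h.tsum_norm_le n)
  refine (mul_le_mul (mul_le_mul_of_nonneg_left h2 (by norm_num)) h3 (norm_nonneg _) ?_).trans_eq ?_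
  · have := (norm_nonneg _).trans h2
    positivity
  · ring

/-- With `S` the sum of the series, `B n - S / 4 * A n` is the small solution. -/
theorem cfDen_sub_eq (h : Admissible α β γ) (n : ℕ) :
    cfDen α β γ n - (∑' k, tailTerm α β γ 0 k) / 4 * cfNum α β γ n = smallSolution α β γ n := by
  refine ((isSolution_solution α β γ 0 1).sub_const_mul (isSolution_solution α β γ 1 _) _).ext
    h.isSolution_smallSolution ?_ ?_ n
  · simp only [solution, smallSolution, poch_zero]
    ring
  · have hsum := h.summable_zero.tsum_eq_zero_add
    have e : ∀ k, tailTerm α β γ 1 k = tailTerm α β γ 0 (k + 1) := tailTerm_one_left α β γ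
    have ha := h.left 0
    have hb := h.right 0
    have ha' : α + 1 ≠ 0 := by rintro h; simp [h] at ha
    have hb' : β + 1 ≠ 0 := by rintro h; simp [h] at hb
    have h0 : (α + 1) * (β + 1) * tailTerm α β γ 0 0 = 4 := by
      rw [tailTerm_zero_left]
      simp only [poch_succ, poch_zero, Nat.cast_zero, add_zero, one_mul, zero_add]
      field_simp
      norm_num
    simp only [solution, smallSolution, poch_succ, poch_zero, e, partDen]
    push_cast
    linear_combination (-1 / 4 * (α + 1) * (β + 1)) * hsum - h0 / 4

theorem isSmall_cfDen_sub (h : Admissible α β γ) : IsSmall fun n =>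
    cfDen α β γ n - (∑' k, tailTerm α β γ 0 k) / 4 * cfNum α β γ n := by
  simpa only [h.cfDen_sub_eq] using h.isSmall_smallSolution

/-! ### Growth of the numerators -/

theorem casoratian_cfNum_cfDen (α β γ : ℂ) :
    cfNum α β γ 1 * cfDen α β γ 0 - cfNum α β γ 0 * cfDen α β γ 1 ≠ 0 := by
  simp [cfNum, cfDen, solution]

theorem grows_cfNum_of_partNum_ne_zero (h : Admissible α β γ)
    (hb : ∀ k, partNum α β γ (k + 1) ≠ 0) : GrowsAt (7 / 5) (cfNum α β γ) := by
  refine (isSolution_solution α β γ 1 _).grows_or_small.resolve_right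
    fun hA : IsSmall (cfNum α β γ) => ?_
  refine (isSolution_solution α β γ 1 (partDen α β 0)).not_isSmall_of_isSmall
    (isSolution_solution α β γ 0 1) (casoratian_cfNum_cfDen α β γ) hb hA ?_
  have := h.isSmall_cfDen_sub.add_const_mul hA ((∑' k, tailTerm α β γ 0 k) / 4)
  change IsSmall (cfDen α β γ)
  simpa only [sub_add_cancel] using this

end Admissible

/-- A shift of the index weakens the rate, since `(j + 1)²` becomes `(N + j + 1)²`; any rate above
`11 / 10` still excludes smallness. -/
theorem GrowsAt.of_shift {X Z : ℕ → ℂ} {N : ℕ} {x : ℂ} (hZ : GrowsAt (7 / 5) Z) (hx : x ≠ 0)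
    (hXZ : ∀ j, X (N + j) = x * Z j) : GrowsAt (13 / 10) X := by
  obtain ⟨J, hJ⟩ := eventually_atTop.1 hZ
  -- For `j ≥ 30 N` the loss is at most `(31 / 30)²`, and `13 / 10 * (31 / 30)² ≤ 7 / 5`.
  filter_upwards [eventually_ge_atTop (N + (J + 30 * N))] with n hn
  obtain ⟨j, rfl⟩ : ∃ j, n = N + j := ⟨n - N, by omega⟩
  have hj : J + 30 * N ≤ j := by omega
  obtain ⟨h1, h2⟩ := hJ j (by omega)
  rw [add_assoc, hXZ, hXZ, norm_mul, norm_mul]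
  refine ⟨mul_ne_zero hx h1, ?_⟩
  have hjr : 30 * (N : ℝ) ≤ j := by exact_mod_cast (by omega : 30 * N ≤ j)
  have hN : (0 : ℝ) ≤ N := N.cast_nonneg
  have h3 : ((N : ℝ) + j + 1) ^ 2 ≤ (31 / 30 * (j + 1)) ^ 2 := by
    gcongr
    linarith
  have h4 : 13 / 10 * ((N : ℝ) + j + 1) ^ 2 ≤ 7 / 5 * (j + 1) ^ 2 := by
    nlinarith [sq_nonneg ((j : ℝ) + 1)]
  push_cast
  calc _ = ‖x‖ * (13 / 10 * ((N : ℝ) + j + 1) ^ 2 * ‖Z j‖) := by ring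
    _ ≤ ‖x‖ * (7 / 5 * (j + 1) ^ 2 * ‖Z j‖) := by gcongr
    _ ≤ _ := by gcongr

/-- If `α = -N` then `b N = 0`, and from the index `N` on every solution is a multiple of the
numerators for the parameters `N`, `N + β`, `N + γ`. -/
theorem IsSolution.shift {β γ : ℂ} {N : ℕ} {X : ℕ → ℂ}
    (hX : IsSolution (-(N + 1 : ℂ)) β γ X) (j : ℕ) :
    X (N + 1 + j) = X (N + 1) * cfNum (N + 1) (N + 1 + β) (N + 1 + γ) j := by
  induction j using Nat.twoStepInduction with
  | zero => simp [cfNum, solution]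
  | one =>
    rw [show N + 1 + 1 = N + 2 by ring, hX N, cfNum, solution, partDen, partDen, partNum]
    push_cast
    ring
  | more j h h' =>
    rw [show N + 1 + (j + 2) = N + 1 + j + 2 by ring, hX, h, add_assoc (N + 1) j 1, h',
      show cfNum (N + 1) (N + 1 + β) (N + 1 + γ) (j + 2) = _ from isSolution_solution _ _ _ _ _ j]
    simp only [cfNum, partNum]
    generalize solution _ _ _ _ _ j = z
    generalize solution _ _ _ _ _ (j + 1) = z'
    simp only [partDen]
    push_cast
    ring

namespace Admissible

variable {α β γ : ℂ}

theorem shift {N : ℕ} (h : Admissible (-(N + 1 : ℂ)) β γ) :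
    Admissible (N + 1) (N + 1 + β) (N + 1 + γ) := by
  -- `N + 1` is even, because `α = -(N + 1)` is not an odd negative integer.
  obtain ⟨l, hl⟩ : ∃ l, N = 2 * l + 1 := by
    rcases Nat.even_or_odd' N with ⟨l, hl | hl⟩
    · exact absurd (by rw [hl]; push_cast; ring) (h.left l)
    · exact ⟨l, hl⟩
  have hN : (0 : ℝ) ≤ N := N.cast_nonneg
  refine ⟨?_, fun m hm => ?_, fun m hm => h.right (m + l + 1) ?_, fun m hm => h.bot (m + N + 1) ?_⟩
  · have := h.re_lt
    simp only [Complex.sub_re, Complex.add_re, Complex.mul_re, Complex.one_re, Complex.neg_re,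
      Complex.re_ofNat, Complex.im_ofNat, zero_mul, sub_zero, Complex.natCast_re] at this ⊢
    linarith
  · have := congrArg Complex.re hm
    have hm0 : (0 : ℝ) ≤ m := m.cast_nonneg
    simp only [Complex.add_re, Complex.div_ofNat_re, Complex.one_re, Complex.neg_re,
      Complex.natCast_re] at this
    linarith
  · rw [hl] at hm
    push_cast at hm ⊢
    linear_combination hm
  · push_cast
    linear_combination hm

theorem partNum_ne_zero (h : Admissible α β γ) {k : ℕ} (hα : α ≠ -(k + 1 : ℂ))
    (hβ : β ≠ -(k + 1 : ℂ)) : partNum α β γ (k + 1) ≠ 0 := by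
  have hk : ((k + 1 : ℕ) : ℂ) ≠ 0 := Nat.cast_ne_zero.2 k.succ_ne_zero
  have h1 : ((k + 1 : ℕ) : ℂ) + α ≠ 0 := fun e => hα (by push_cast at e; linear_combination e)
  have h2 : ((k + 1 : ℕ) : ℂ) + β ≠ 0 := fun e => hβ (by push_cast at e; linear_combination e)
  have h3 : ((k + 1 : ℕ) : ℂ) + γ ≠ 0 := fun e => h.bot k (by push_cast at e; linear_combination e)
  rw [partNum]
  exact mul_ne_zero (mul_ne_zero (mul_ne_zero (mul_ne_zero (by norm_num) hk) h1) h2) h3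

/-- If `b` vanishes at `N + 1 = -α` for the first time, the growth of the numerators follows from
that for the shifted parameters: the small solution `B - S / 4 * A` has to vanish at `N + 1`, so
`A (N + 1) = 0` would entail `B (N + 1) = 0`, against the Casoratian. -/
theorem grows_cfNum_of_shift {N : ℕ} (h : Admissible (-(N + 1 : ℂ)) β γ)
    (hb : ∀ k < N, partNum (-(N + 1 : ℂ)) β γ (k + 1) ≠ 0)
    (hg : GrowsAt (7 / 5) (cfNum (N + 1) (N + 1 + β) (N + 1 + γ))) :
    GrowsAt (7 / 5) (cfNum (-(N + 1 : ℂ)) β γ) := by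
  have solA := isSolution_solution (-(N + 1 : ℂ)) β γ 1 (partDen (-(N + 1 : ℂ)) β 0)
  have solB := isSolution_solution (-(N + 1 : ℂ)) β γ 0 1
  have hM := h.isSmall_cfDen_sub
  set s := (∑' k, tailTerm (-(N + 1 : ℂ)) β γ 0 k) / 4
  have hM0 : cfDen (-(N + 1 : ℂ)) β γ (N + 1) - s * cfNum (-(N + 1 : ℂ)) β γ (N + 1) = 0 := by
    by_contra hne
    exact (hg.of_shift hne (solB.sub_const_mul solA s).shift).not_isSmall hM
  have hcas := solA.casoratian_ne_zero solB (casoratian_cfNum_cfDen _ _ _) N hb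
  have hA : cfNum (-(N + 1 : ℂ)) β γ (N + 1) ≠ 0 := by
    intro h0
    rw [h0, mul_zero, sub_zero] at hM0
    apply hcas
    change cfNum _ β γ (N + 1) * cfDen _ β γ N - cfNum _ β γ N * cfDen _ β γ (N + 1) = 0
    rw [h0, hM0]
    ring
  exact solA.grows_or_small.resolve_right (hg.of_shift hA solA.shift).not_isSmall

theorem cfNum_comm (α β γ : ℂ) : cfNum α β γ = cfNum β α γ := by
  have h1 (n : ℕ) : partDen α β n = partDen β α n := by unfold partDen; ring
  have h2 (n : ℕ) : partNum α β γ n = partNum β α γ n := by unfold partNum; ring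
  funext n
  refine IsSolution.ext (Y := cfNum β α γ) (isSolution_solution α β γ 1 (partDen α β 0))
    (fun n => ?_) rfl ?_ n
  · rw [h1, h2]
    exact isSolution_solution β α γ 1 _ n
  · simp only [cfNum, solution, h1]

theorem grows_cfNum_of_left_ne (h : Admissible α β γ) (hα : ∀ k : ℕ, α ≠ -(k + 1 : ℂ)) :
    GrowsAt (7 / 5) (cfNum α β γ) := by
  by_cases hβ : ∃ N : ℕ, β = -(N + 1 : ℂ)
  · obtain ⟨N, rfl⟩ := hβ
    rw [cfNum_comm]
    refine h.symm.grows_cfNum_of_shift (fun k hk => h.symm.partNum_ne_zero (fun e => ?_) (hα k))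
      (h.symm.shift.grows_cfNum_of_partNum_ne_zero fun k =>
        h.symm.shift.partNum_ne_zero (fun e => ?_) fun e => hα (k + N + 1) ?_)
    · have e' : (N : ℂ) = k := by linear_combination -e
      exact hk.ne' (Nat.cast_injective e')
    · have e' : ((N + 1 + k + 1 : ℕ) : ℂ) = 0 := by push_cast; linear_combination e
      exact absurd (Nat.cast_eq_zero.1 e') (by omega)
    · push_cast
      linear_combination e
  · push Not at hβ
    exact h.grows_cfNum_of_partNum_ne_zero fun k => h.partNum_ne_zero (hα k) (hβ k)

theorem grows_cfNum (h : Admissible α β γ) : GrowsAt (7 / 5) (cfNum α β γ) := by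
  -- It suffices to treat the case where `α` is the first to make `b` vanish.
  have key {N : ℕ} {β : ℂ} (h : Admissible (-(N + 1 : ℂ)) β γ)
      (hb : ∀ k < N, partNum (-(N + 1 : ℂ)) β γ (k + 1) ≠ 0) :
      GrowsAt (7 / 5) (cfNum (-(N + 1 : ℂ)) β γ) := by
    refine h.grows_cfNum_of_shift hb (h.shift.grows_cfNum_of_left_ne fun k e => ?_)
    have e' : ((N + 1 + k + 1 : ℕ) : ℂ) = 0 := by push_cast; linear_combination e
    exact absurd (Nat.cast_eq_zero.1 e') (by omega)
  classical
  by_cases hz : ∃ N : ℕ, partNum α β γ (N + 1) = 0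
  · have hspec := Nat.find_spec hz
    have hmin : ∀ k < Nat.find hz, partNum α β γ (k + 1) ≠ 0 := fun k hk => Nat.find_min hz hk
    generalize Nat.find hz = N at hspec hmin
    by_cases hα : α = -(N + 1 : ℂ)
    · subst hα
      exact key h hmin
    · have hβ : β = -(N + 1 : ℂ) := by
        by_contra hβ
        exact h.partNum_ne_zero hα hβ hspec
      subst hβ
      rw [cfNum_comm]
      refine key h.symm fun k hk e => hmin k hk ?_
      rw [← e, partNum, partNum]
      ring
  · push Not at hz
    exact h.grows_cfNum_of_partNum_ne_zero hz

theorem tendsto_cfDen_div_cfNum (h : Admissible α β γ) :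
    Tendsto (fun n => cfDen α β γ n / cfNum α β γ n) atTop
      (𝓝 ((∑' k, tailTerm α β γ 0 k) / 4)) := by
  have hg := h.grows_cfNum
  have h1 := (h.isSmall_cfDen_sub.tendsto_div (hg.mono (by norm_num))).const_add
    ((∑' k, tailTerm α β γ 0 k) / 4)
  rw [add_zero] at h1
  refine h1.congr' ?_
  filter_upwards [hg] with n hn
  rw [sub_div, mul_div_cancel_right₀ _ hn.1]
  ring

end Admissible

/-! ### The value of the continued fraction -/

theorem contsAux_contFrac (α β γ : ℂ) (n : ℕ) :
    (contFrac (fwdDiff 1 fun n : ℕ => (n : ℂ) * (n + α) * (n + β))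
      (fun n : ℕ => -2 * (n : ℂ) * (n + α) * (n + β) * (n + γ))).contsAux n =
    ⟨cfNum α β γ n, cfDen α β γ n⟩ := by
  have hd (n : ℕ) : fwdDiff 1 (fun n : ℕ => (n : ℂ) * (n + α) * (n + β)) n = partDen α β n := by
    simp [fwdDiff, partDen]
  induction n using Nat.twoStepInduction with
  | zero => rfl
  | one =>
    rw [GenContFract.first_contAux_eq_h_one]
    simp [contFrac, hd, cfNum, cfDen, solution]
  | more n h h' =>
    rw [GenContFract.contsAux_recurrence (gp := ⟨partNum α β γ (n + 1), partDen α β (n + 1)⟩)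
      ?_ h h']
    · simp only [cfNum, cfDen, solution]
    · rw [← hd]
      rfl

theorem sphereDiv_eq_of_ne_zero {p : ℂ} (hp : p ≠ 0) (q : ℂ) :
    sphereDiv p q = sphereDiv 1 (q / p) := by
  by_cases hq : q = 0 <;> simp [sphereDiv, hp, hq]

/-- Inversion `z ↦ 1 / z` is continuous as a map from `ℂ` to the Riemann sphere. -/
theorem continuous_sphereDiv_one : Continuous (sphereDiv 1) := by
  refine continuous_iff_continuousAt.2 fun z => ?_
  by_cases hz : z = 0
  · subst hz
    have h0 : sphereDiv 1 0 = OnePoint.infty := if_pos rfl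
    rw [ContinuousAt, h0, ← nhdsNE_sup_pure, tendsto_sup, tendsto_pure_left]
    refine ⟨?_, fun s hs => h0 ▸ mem_of_mem_nhds hs⟩
    have h1 : Tendsto (fun z : ℂ => ((z⁻¹ : ℂ) : OnePoint ℂ)) (𝓝[≠] 0) (𝓝 OnePoint.infty) := by
      refine OnePoint.tendsto_coe_infty.comp ?_
      rw [coclosedCompact_eq_cocompact, ← Metric.cobounded_eq_cocompact]
      exact tendsto_inv₀_nhdsNE_zero
    refine h1.congr' ?_
    filter_upwards [self_mem_nhdsWithin] with z (hz : z ≠ 0)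
    rw [sphereDiv, if_neg hz, one_div]
  · have h1 : ContinuousAt (fun z : ℂ => ((z⁻¹ : ℂ) : OnePoint ℂ)) z :=
      OnePoint.continuous_coe.continuousAt.comp (continuousAt_inv₀ hz)
    refine h1.congr ?_
    filter_upwards [isOpen_ne.mem_nhds hz] with w hw
    rw [sphereDiv, if_neg hw, one_div]

theorem theorem2p1 (α β γ : ℂ)
    (hre : (2 * γ - α - β).re < 1)
    (hα : ∀ m : ℕ, (α + 1) / 2 ≠ -(m : ℂ))
    (hβ : ∀ m : ℕ, (β + 1) / 2 ≠ -(m : ℂ))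
    (hγ : ∀ m : ℕ, γ + 1 ≠ -(m : ℂ)) :
    ∃ S : ℂ,
      HasSum (fun n : ℕ =>
        poch (1 / 2) n * poch (γ + 1) n /
          (poch ((α + 1) / 2) (n + 1) * poch ((β + 1) / 2) (n + 1))) S ∧
      HasCFValue
        (contFrac
          (fwdDiff 1 fun n : ℕ => (n : ℂ) * (n + α) * (n + β))
          (fun n : ℕ => -2 * (n : ℂ) * (n + α) * (n + β) * (n + γ)))
        (sphereDiv 4 S) := by
  have h : Admissible α β γ := ⟨hre, hα, hβ, hγ⟩
  refine ⟨∑' k, tailTerm α β γ 0 k, ?_, ?_⟩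
  · convert h.summable_zero.hasSum using 1
    exact funext fun k => (tailTerm_zero_left α β γ k).symm
  · have hA : ∀ᶠ n in atTop, cfNum α β γ (n + 1) ≠ 0 :=
      (tendsto_add_atTop_nat 1).eventually
        (Eventually.mono h.grows_cfNum fun _ hn => hn.1)
    simp only [HasCFValue, GenContFract.num_eq_conts_a, GenContFract.den_eq_conts_b,
      GenContFract.nth_cont_eq_succ_nth_contAux, contsAux_contFrac]
    refine ⟨hA.mono fun n hn => Or.inl hn, ?_⟩
    rw [sphereDiv_eq_of_ne_zero (by norm_num)]
    refine ((continuous_sphereDiv_one.tendsto _).comp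
      (h.tendsto_cfDen_div_cfNum.comp (tendsto_add_atTop_nat 1))).congr' ?_
    filter_upwards [hA] with n hn
    exact (sphereDiv_eq_of_ne_zero hn _).symm
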